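/- Let $A$ and $B$ be unital complex Banach algebras, with units $e_A$ and $e_B$, and let $n\ge 1$ be an integer. Let $\varphi\colon A\to B$ be a linear map which is unital, i.e. $\varphi(e_A)=e_B$, and which is a mixed $n$-Jordan homomorphism, i.e. $\varphi(a^n b)=\varphi(a)^n\varphi(b)$ for all $a,b\in A$. Then $\varphi$ is continuous under each one of the following conditions: (i) $B$ is semisimple (its Jacobson radical, the intersection of all maximal left ideals of $B$, is $\{0\}$) and commutative; (ii) $B$ is semisimple and $\varphi$ is surjective; (iii) $B$ is a $C^*$-algebra and $\varphi$ is surjective. -/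

import Mathlib

/-- A linear map `φ : A → B` between (unital) complex algebras is a mixed `n`-Jordan homomorphism
if `φ (a ^ n * b) = φ a ^ n * φ b` for all `a b : A`. -/
def IsMixedJordanHom {A B : Type*} [Ring A] [Algebra ℂ A] [Ring B] [Algebra ℂ B]
    (n : ℕ) (φ : A →ₗ[ℂ] B) : Prop :=
  ∀ a b : A, φ (a ^ n * b) = φ a ^ n * φ b

/-- A unital algebra is semisimple if its Jacobson radical, the intersection of all maximal left
ideals, is zero. (As `B` has a unit, every left ideal is modular.) -/
def IsJacobsonSemisimple (B : Type*) [Ring B] : Prop :=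
  Ring.jacobson B = ⊥

/-- A complex Banach algebra, with its given norm, is a C⋆-algebra if it carries a conjugate-linear
involution, reversing products, with `‖star x * x‖ = ‖x‖ * ‖x‖`. -/
def IsCStarAlgebra (B : Type*) [NormedRing B] [NormedAlgebra ℂ B] [CompleteSpace B] : Prop :=
  ∃ _ : StarRing B, StarModule ℂ B ∧ CStarRing B

/-!
A unital mixed `n`-Jordan homomorphism `φ` is multiplicative: `φ ((t • a + 1) ^ n * b)` and
`(t • φ a + 1) ^ n * φ b` are equal polynomials in `t`, and comparing the coefficients of `t` gives
`n • φ (a * b) = n • (φ a * φ b)`. What remains is the automatic continuity of algebra homomorphisms.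

By the closed graph theorem it suffices that every `y` in the separating space of `φ`, that is
`y = lim φ (u k)` for some `u k → 0`, is zero. As `B` is semisimple, it is enough that all products
`x * y` are quasinilpotent (`AlgHom.continuous_of_separating`).

* If `B` is commutative, then each character `χ` of `B` is continuous, and so is the character
  `χ ∘ φ` of `A`; hence `χ y = lim χ (φ (u k)) = 0`, and the spectrum of `x * y` consists of values
  of characters.
* If `φ` is surjective, then the separating space is a left ideal, so only `y = φ a` itself has to
  be treated. This is Ransford's proof of Johnson's theorem. The affine function
  `p z = φ (a - u k) + z • φ (u k)` satisfies `p 1 = y`. On the circle of radius `R`, the spectral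
  radius of `p z` is at most that of `a - u k + z • u k`, which is eventually bounded independently
  of `R`; on the circle of radius `R⁻¹`, the norm of `p z` is eventually `O(R⁻¹)`. A three circles
  inequality (`sq_norm_le_of_mem_spectrum_add`) bounds the square of the spectral radius of `y` by
  a constant times `R⁻¹`, and `R` is arbitrary.

The three circles inequality comes from the maximum principle on an annulus, applied to high powers
of `p z`, with Gelfand's formula made uniform on the outer circle by compactness.
A C⋆-algebra is semisimple (`CStarAlgebra.isJacobsonSemisimple`), so the last case is an instance of
Johnson's theorem.
-/

/-! ### Mixed Jordan homomorphisms -/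

theorem eq_zero_of_forall_sum_pow_smul_eq_zero {V : Type*} [AddCommGroup V] [Module ℂ V]
    {N : ℕ} (w : ℕ → V) (h : ∀ t : ℂ, ∑ k ∈ Finset.range N, t ^ k • w k = 0) {k : ℕ} (hk : k < N) :
    w k = 0 := by
  rw [← Module.forall_dual_apply_eq_zero_iff ℂ]
  intro f
  have hP : (∑ k ∈ Finset.range N, Polynomial.C (f (w k)) * Polynomial.X ^ k) = 0 := by
    refine Polynomial.funext fun t => ?_
    have := congrArg f (h t)
    rw [map_sum, map_zero] at this
    rw [Polynomial.eval_finsetSum, Polynomial.eval_zero, ← this]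
    refine Finset.sum_congr rfl fun k _ => ?_
    rw [Polynomial.eval_mul, Polynomial.eval_C, Polynomial.eval_X_pow, map_smul, smul_eq_mul,
      mul_comm]
  have := congrArg (fun P => Polynomial.coeff P k) hP
  simpa [Polynomial.finsetSum_coeff, Polynomial.coeff_C_mul, Polynomial.coeff_X_pow, hk] using this

/-- Compare the coefficients of `t` in `φ ((t • a + 1) ^ n * b) = φ (t • a + 1) ^ n * φ b`. -/
theorem IsMixedJordanHom.map_mul {A B : Type*} [Ring A] [Algebra ℂ A] [Ring B] [Algebra ℂ B]
    {n : ℕ} (hn : 1 ≤ n) {φ : A →ₗ[ℂ] B} (hunital : φ 1 = 1) (hφ : IsMixedJordanHom n φ)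
    (a b : A) : φ (a * b) = φ a * φ b := by
  have key := eq_zero_of_forall_sum_pow_smul_eq_zero (N := n + 1)
    (fun k => (n.choose k : ℂ) • (φ (a ^ k * b) - φ a ^ k * φ b)) (fun t => by
      have h := hφ (t • a + 1) b
      rw [map_add, map_smul, hunital, (Commute.one_right _).add_pow,
        (Commute.one_right _).add_pow, Finset.sum_mul, Finset.sum_mul, map_sum, ← sub_eq_zero,
        ← Finset.sum_sub_distrib] at h
      rw [← h]
      refine Finset.sum_congr rfl fun k _ => ?_
      simp only [smul_pow, one_pow, mul_one, ← nsmul_eq_mul', smul_mul_assoc, map_nsmul, map_smul]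
      rw [← smul_sub, ← smul_sub, Nat.cast_smul_eq_nsmul, smul_comm]) (k := 1) (by omega)
  simp only [pow_one, Nat.choose_one_right, smul_eq_zero, Nat.cast_eq_zero] at key
  exact sub_eq_zero.1 (key.resolve_left (by omega))

/-! ### A three circles inequality for the spectral radius -/

theorem sq_norm_apply_one_le_of_norm_le_on_circles {E : Type*} [NormedAddCommGroup E]
    [NormedSpace ℂ E] {f : ℂ → E} (hf : Differentiable ℂ f) {R : ℝ} (hR : 1 < R) {M m : ℝ}
    (hM : ∀ z : ℂ, ‖z‖ = R → ‖f z‖ ≤ M) (hm : ∀ z : ℂ, ‖z‖ = R⁻¹ → ‖f z‖ ≤ m) :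
    ‖f 1‖ ^ 2 ≤ M * m := by
  obtain ⟨g, hg, hg1⟩ := exists_dual_vector'' ℂ (f 1)
  have hR0 : 0 < R := by linarith
  have hgf : ∀ z, ‖g (f z)‖ ≤ ‖f z‖ := fun z => by
    simpa using g.le_of_opNorm_le hg (f z)
  set U : Set ℂ := {z | R⁻¹ < ‖z‖ ∧ ‖z‖ < R}
  have hUo : IsOpen U :=
    (isOpen_lt continuous_const continuous_norm).inter (isOpen_lt continuous_norm continuous_const)
  have hUcl : closure U ⊆ {z | R⁻¹ ≤ ‖z‖ ∧ ‖z‖ ≤ R} :=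
    closure_minimal (fun z hz => ⟨hz.1.le, hz.2.le⟩)
      ((isClosed_le continuous_const continuous_norm).inter
        (isClosed_le continuous_norm continuous_const))
  have hbdd : Bornology.IsBounded U :=
    (Metric.isBounded_closedBall (x := (0 : ℂ)) (r := R)).subset fun z hz => by
      simpa using hz.2.le
  -- the symmetric product takes the same bound `M * m` on both boundary circles
  have hd : DiffContOnCl ℂ (fun z => g (f z) * g (f z⁻¹)) U := by
    refine DifferentiableOn.diffContOnCl fun z hz => ?_
    have hz0 : z ≠ 0 := fun h => by
      have := (hUcl hz).1
      rw [h, norm_zero] at this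
      exact absurd this (not_le.2 (inv_pos.2 hR0))
    have h1 : Differentiable ℂ fun z => g (f z) := g.differentiable.comp hf
    exact ((h1 z).mul ((h1 z⁻¹).comp z (differentiableAt_inv hz0))).differentiableWithinAt
  have hfr : ∀ z ∈ frontier U, ‖g (f z) * g (f z⁻¹)‖ ≤ M * m := by
    intro z hz
    rw [hUo.frontier_eq] at hz
    have h1 := hUcl hz.1
    rw [norm_mul]
    rcases h1.1.eq_or_lt with h | h
    · rw [mul_comm]
      exact mul_le_mul ((hgf _).trans (hM _ (by rw [norm_inv, ← h, inv_inv])))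
        ((hgf _).trans (hm _ h.symm)) (norm_nonneg _)
        ((norm_nonneg _).trans (hM R (by simp [abs_of_pos hR0])))
    · have h' : ‖z‖ = R := le_antisymm h1.2 (not_lt.1 fun h2 => hz.2 ⟨h, h2⟩)
      exact mul_le_mul ((hgf _).trans (hM _ h')) ((hgf _).trans (hm _ (by rw [norm_inv, h'])))
        (norm_nonneg _) ((norm_nonneg _).trans (hM R (by simp [abs_of_pos hR0])))
  have h1U : (1 : ℂ) ∈ U := by
    simpa [U] using ⟨inv_lt_one_of_one_lt₀ hR, hR⟩
  have := Complex.norm_le_of_forall_mem_frontier_norm_le hbdd hd hfr (subset_closure h1U)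
  simpa [hg1, sq] using this

/-- A version of Dini's theorem for Gelfand's formula: along powers of two, the condition
`‖x ^ k‖ < M ^ k` persists, so compactness yields one exponent for all points. -/
theorem exists_forall_norm_pow_le_of_spectralRadius_lt {X A : Type*} [TopologicalSpace X]
    [NormedRing A] [NormedAlgebra ℂ A] [CompleteSpace A] {K : Set X} (hK : IsCompact K)
    {p : X → A} (hp : Continuous p) {M : NNReal}
    (hM : ∀ z ∈ K, spectralRadius ℂ (p z) < M) :
    ∃ N : ℕ, 0 < N ∧ ∀ z ∈ K, ‖p z ^ N‖ ≤ (M : ℝ) ^ N := by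
  let U : ℕ → Set X := fun k => {z | ‖p z ^ 2 ^ k‖ < (M : ℝ) ^ 2 ^ k}
  have hmono : Monotone U := by
    refine monotone_nat_of_le_succ fun k z hz => ?_
    change ‖p z ^ 2 ^ (k + 1)‖ < (M : ℝ) ^ 2 ^ (k + 1)
    rw [pow_succ 2 k, pow_mul, pow_mul]
    exact (norm_pow_le' _ two_pos).trans_lt
      (pow_lt_pow_left₀ hz (norm_nonneg _) two_ne_zero)
  obtain ⟨k, hk⟩ := hK.elim_directed_cover U
    (fun k => isOpen_lt (by fun_prop) continuous_const) (fun z hz => by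
      have h := ((spectrum.pow_nnnorm_pow_one_div_tendsto_nhds_spectralRadius (p z)).comp
        (tendsto_pow_atTop_atTop_of_one_lt (one_lt_two (α := ℕ)))).eventually_lt_const (hM z hz)
      obtain ⟨k, hk⟩ := h.exists
      refine Set.mem_iUnion.2 ⟨k, ?_⟩
      have hpos : (0 : ℝ) < ((2 ^ k : ℕ) : ℝ) := by positivity
      have h2 := ENNReal.rpow_lt_rpow hk hpos
      simp only [Function.comp_apply] at h2
      rw [← ENNReal.rpow_mul, one_div_mul_cancel hpos.ne', ENNReal.rpow_one,
        ENNReal.rpow_natCast] at h2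
      change ‖p z ^ 2 ^ k‖ < (M : ℝ) ^ 2 ^ k
      exact_mod_cast h2) hmono.directed_le
  exact ⟨2 ^ k, by positivity, fun z hz => (hk hz).le⟩

/-- The three circles inequality for the affine function `u + z • v`, whose spectral radius is bounded
by `M` on the outer circle and whose norm is bounded by `m` on
the inner circle. The constant `‖1‖ ^ 2 + 1` is there because the norm of `1` need not be `1`. -/
theorem sq_norm_le_of_mem_spectrum_add {B : Type*} [NormedRing B] [NormedAlgebra ℂ B]
    [CompleteSpace B] (u v : B) {R : ℝ} (hR : 1 < R) {M : NNReal} {m : ℝ}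
    (hM : ∀ z : ℂ, ‖z‖ = R → spectralRadius ℂ (u + z • v) < M)
    (hm : ∀ z : ℂ, ‖z‖ = R⁻¹ → ‖u + z • v‖ ≤ m) {c : ℂ} (hc : c ∈ spectrum ℂ (u + v)) :
    ‖c‖ ^ 2 ≤ M * m * (‖(1 : B)‖ ^ 2 + 1) := by
  have hR0 : 0 < R := by linarith
  have hm0 : 0 ≤ m := (norm_nonneg _).trans (hm (R⁻¹ : ℝ) (by simp [abs_of_pos hR0]))
  obtain ⟨N, hN, hN'⟩ := exists_forall_norm_pow_le_of_spectralRadius_lt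
    (isCompact_sphere (0 : ℂ) R) (p := fun z => u + z • v) (by fun_prop) (M := M)
    (fun z hz => hM z (by simpa using hz))
  have h3 := sq_norm_apply_one_le_of_norm_le_on_circles (f := fun z : ℂ => (u + z • v) ^ N)
    (by fun_prop) hR (fun z hz => hN' z (by simpa using hz))
    (fun z hz => (norm_pow_le' _ hN).trans (pow_le_pow_left₀ (norm_nonneg _) (hm z hz) N))
  simp only [one_smul] at h3
  have h4 := spectrum.norm_le_norm_mul_of_mem (spectrum.pow_mem_pow _ N hc)
  rw [norm_pow] at h4
  refine le_of_pow_le_pow_left₀ hN.ne' (by positivity) ?_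
  calc (‖c‖ ^ 2) ^ N = (‖c‖ ^ N) ^ 2 := by ring
    _ ≤ (‖(u + v) ^ N‖ * ‖(1 : B)‖) ^ 2 := pow_le_pow_left₀ (by positivity) h4 2
    _ = ‖(u + v) ^ N‖ ^ 2 * ‖(1 : B)‖ ^ 2 := by ring
    _ ≤ (M ^ N * m ^ N) * (‖(1 : B)‖ ^ 2 + 1) ^ N := by
      refine mul_le_mul h3 ?_ (by positivity) (by positivity)
      exact (le_add_of_nonneg_right zero_le_one).trans
        (le_self_pow₀ (le_add_of_nonneg_left (by positivity)) hN.ne')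
    _ = (M * m * (‖(1 : B)‖ ^ 2 + 1)) ^ N := by rw [← mul_pow, ← mul_pow]

/-! ### The separating space -/

/-- An element of the range of a homomorphism `φ` which lies in the separating space of `φ` is
quasinilpotent. -/
theorem AlgHom.eq_zero_of_mem_spectrum_of_tendsto {A B : Type*}
    [NormedRing A] [NormedAlgebra ℂ A] [CompleteSpace A]
    [NormedRing B] [NormedAlgebra ℂ B] [CompleteSpace B] (φ : A →ₐ[ℂ] B)
    {u : ℕ → A} {a : A} (hu : Filter.Tendsto u Filter.atTop (nhds 0))
    (hφu : Filter.Tendsto (fun k => φ (u k)) Filter.atTop (nhds (φ a)))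
    {c : ℂ} (hc : c ∈ spectrum ℂ (φ a)) : c = 0 := by
  let M : NNReal := (‖a‖₊ + 1) * ‖(1 : A)‖₊ + 1
  have key : ∀ R : ℝ, 1 < R → ‖c‖ ^ 2 ≤ M * ((‖φ a‖ + 2) * R⁻¹) * (‖(1 : B)‖ ^ 2 + 1) := by
    intro R hR
    have hR0 : 0 < R := by linarith
    have e1 : ∀ᶠ k in Filter.atTop, ‖a - u k‖ + R * ‖u k‖ < ‖a‖ + 1 := by
      have : Filter.Tendsto (fun k => ‖a - u k‖ + R * ‖u k‖) Filter.atTop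
          (nhds (‖a - 0‖ + R * ‖(0 : A)‖)) :=
        (tendsto_const_nhds.sub hu).norm.add (hu.norm.const_mul R)
      exact this.eventually_lt_const (by simp)
    have e2 : ∀ᶠ k in Filter.atTop,
        ‖φ a - φ (u k)‖ + R⁻¹ * ‖φ (u k)‖ < (‖φ a‖ + 2) * R⁻¹ := by
      have : Filter.Tendsto (fun k => ‖φ a - φ (u k)‖ + R⁻¹ * ‖φ (u k)‖) Filter.atTop
          (nhds (‖φ a - φ a‖ + R⁻¹ * ‖φ a‖)) :=
        (tendsto_const_nhds.sub hφu).norm.add (hφu.norm.const_mul R⁻¹)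
      refine this.eventually_lt_const ?_
      have : 0 < R⁻¹ := inv_pos.2 hR0
      simp only [sub_self, norm_zero]
      nlinarith
    obtain ⟨k, h1, h2⟩ := (e1.and e2).exists
    -- `φ a` is the value at `z = 1` of the affine function `φ (a - u k) + z • φ (u k)`
    refine sq_norm_le_of_mem_spectrum_add (φ a - φ (u k)) (φ (u k)) hR (fun z hz => ?_)
      (fun z hz => ?_) (by simpa using hc)
    · -- a homomorphism shrinks spectra, so the norm of `A` controls the spectral radius
      have hle : spectralRadius ℂ (φ a - φ (u k) + z • φ (u k)) ≤
          ((‖a‖₊ + 1) * ‖(1 : A)‖₊ : NNReal) := by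
        refine iSup₂_le fun d hd => ?_
        have hd' : d ∈ spectrum ℂ (a - u k + z • u k) :=
          AlgHom.spectrum_apply_subset φ _ (by simpa using hd)
        have h3 : ‖a - u k + z • u k‖ ≤ ‖a‖ + 1 :=
          (norm_add_le _ _).trans (by rw [norm_smul, hz]; exact h1.le)
        have h4 : ‖d‖ ≤ (‖a‖ + 1) * ‖(1 : A)‖ := (spectrum.norm_le_norm_mul_of_mem hd').trans
          (mul_le_mul_of_nonneg_right h3 (norm_nonneg _))
        exact_mod_cast h4
      exact hle.trans_lt (by
        rw [ENNReal.coe_lt_coe]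
        exact lt_add_one _)
    · exact (norm_add_le _ _).trans (by rw [norm_smul, hz]; exact h2.le)
  have hlim : Filter.Tendsto
      (fun R : ℝ => (M : ℝ) * ((‖φ a‖ + 2) * R⁻¹) * (‖(1 : B)‖ ^ 2 + 1)) Filter.atTop (nhds 0) := by
    simpa using ((tendsto_inv_atTop_zero.const_mul (‖φ a‖ + 2)).const_mul (M : ℝ)).mul_const
      (‖(1 : B)‖ ^ 2 + 1)
  have h0 : ‖c‖ ^ 2 ≤ 0 := ge_of_tendsto hlim ((Filter.eventually_gt_atTop 1).mono key)
  simpa using le_antisymm h0 (sq_nonneg _)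

theorem mem_ringJacobson_of_forall_spectrum_mul_subset {B : Type*} [Ring B] [Algebra ℂ B] {y : B}
    (h : ∀ x : B, spectrum ℂ (x * y) ⊆ {0}) : y ∈ Ring.jacobson B := by
  rw [← Ideal.jacobson_bot, Ideal.mem_jacobson_iff]
  intro x
  have h1 : (-1 : ℂ) ∉ spectrum ℂ (x * y) := fun hm => by simpa using h x hm
  rw [spectrum.notMem_iff] at h1
  have h2 : IsUnit (x * y + 1) := by
    convert! h1.neg using 1
    simp
  obtain ⟨z, hz⟩ := h2.exists_left_inv
  refine ⟨z, ?_⟩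
  rw [Ideal.mem_bot, sub_eq_zero, ← hz]
  noncomm_ring

/-- By the closed graph theorem, a linear map is continuous once its separating space vanishes;
here it vanishes because it consists of elements of the Jacobson radical. -/
theorem AlgHom.continuous_of_separating {A B : Type*}
    [NormedRing A] [NormedAlgebra ℂ A] [CompleteSpace A]
    [NormedRing B] [NormedAlgebra ℂ B] [CompleteSpace B] (hB : IsJacobsonSemisimple B)
    (φ : A →ₐ[ℂ] B)
    (h : ∀ (u : ℕ → A) (y : B), Filter.Tendsto u Filter.atTop (nhds 0) →
      Filter.Tendsto (fun k => φ (u k)) Filter.atTop (nhds y) →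
      ∀ x : B, spectrum ℂ (x * y) ⊆ {0}) : Continuous φ := by
  refine φ.toLinearMap.continuous_of_seq_closed_graph fun u x y hu hφu => ?_
  have hy : y - φ x ∈ Ring.jacobson B := by
    refine mem_ringJacobson_of_forall_spectrum_mul_subset (h (fun k => u k - x) _ ?_ ?_)
    · simpa using hu.sub_const x
    · simpa using hφu.sub_const (φ x)
  rw [hB, Ideal.mem_bot, sub_eq_zero] at hy
  exact hy

/-! ### Automatic continuity -/

/-- **Johnson's theorem**: a surjective homomorphism onto a semisimple Banach algebra is
continuous. Surjectivity makes the separating space a left ideal contained in the range. -/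
theorem AlgHom.continuous_of_surjective {A B : Type*}
    [NormedRing A] [NormedAlgebra ℂ A] [CompleteSpace A]
    [NormedRing B] [NormedAlgebra ℂ B] [CompleteSpace B] (hB : IsJacobsonSemisimple B)
    (φ : A →ₐ[ℂ] B) (hφ : Function.Surjective φ) : Continuous φ := by
  refine φ.continuous_of_separating hB fun u y hu hy x c hc => ?_
  obtain ⟨b, rfl⟩ := hφ x
  obtain ⟨a, rfl⟩ := hφ y
  rw [← map_mul] at hc
  refine φ.eq_zero_of_mem_spectrum_of_tendsto (u := fun k => b * u k) (a := b * a) ?_ ?_ hc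
  · simpa using hu.const_mul b
  · simpa using hy.const_mul (φ b)

/-- Characters of `B` and their pullbacks to `A` are continuous, so every character of `B`
vanishes on the separating space. -/
theorem AlgHom.continuous_of_commutative {A B : Type*}
    [NormedRing A] [NormedAlgebra ℂ A] [CompleteSpace A]
    [NormedCommRing B] [NormedAlgebra ℂ B] [CompleteSpace B] (hB : IsJacobsonSemisimple B)
    (φ : A →ₐ[ℂ] B) : Continuous φ := by
  refine φ.continuous_of_separating hB fun u y hu hy x c hc => ?_
  obtain ⟨f, rfl⟩ := WeakDual.CharacterSpace.mem_spectrum_iff_exists.1 hc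
  let χ : B →ₐ[ℂ] ℂ := WeakDual.CharacterSpace.toAlgHom f
  have h1 : Filter.Tendsto (fun k => χ (φ (u k))) Filter.atTop (nhds (χ y)) :=
    ((map_continuous χ).tendsto y).comp hy
  have h2 : Filter.Tendsto (fun k => χ (φ (u k))) Filter.atTop (nhds 0) := by
    have h := ((map_continuous (χ.comp φ)).tendsto 0).comp hu
    rwa [map_zero] at h
  have h3 : f y = 0 := tendsto_nhds_unique h1 h2
  simp [h3]

theorem isUnit_add_one_of_mem_ringJacobson {R : Type*} [Ring R] {x : R}
    (hx : x ∈ Ring.jacobson R) : IsUnit (x + 1) := by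
  rw [← Ideal.jacobson_bot] at hx
  obtain ⟨s, hs⟩ := Ideal.exists_mul_add_sub_mem_of_mem_jacobson x hx
  rw [Ideal.mem_bot, sub_eq_zero] at hs
  -- the left inverse `s` is again congruent to `1`, hence has a left inverse itself
  have hs1 : s - 1 ∈ Ideal.jacobson (⊥ : Ideal R) := by
    have : s - 1 = -s * x := by
      rw [← hs]
      noncomm_ring
    rw [this]
    exact Ideal.mul_mem_left _ _ hx
  obtain ⟨t, ht⟩ := Ideal.exists_mul_sub_mem_of_sub_one_mem_jacobson s hs1
  rw [Ideal.mem_bot, sub_eq_zero] at ht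
  have : t = x + 1 := left_inv_eq_right_inv ht hs
  exact ⟨⟨x + 1, s, this ▸ ht, hs⟩, rfl⟩

theorem spectrum_subset_of_mem_ringJacobson {B : Type*} [Ring B] [Algebra ℂ B] {x : B}
    (hx : x ∈ Ring.jacobson B) : spectrum ℂ x ⊆ {0} := by
  intro c hc
  by_contra hc0
  rw [Set.mem_singleton_iff] at hc0
  refine (spectrum.mem_iff.1 hc) ?_
  have h1 := isUnit_add_one_of_mem_ringJacobson
    (Ideal.mul_mem_left _ (algebraMap ℂ B (-c⁻¹)) hx)
  have h2 := ((IsUnit.mk0 c hc0).map (algebraMap ℂ B)).mul h1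
  convert! h2 using 1
  rw [mul_add, ← mul_assoc, ← map_mul]
  simp [hc0, sub_eq_neg_add]

/-- If `x` lies in the radical, then so does `star x * x`, whose norm `‖x‖ ^ 2` equals its spectral
radius because it is self-adjoint. -/
theorem CStarAlgebra.isJacobsonSemisimple {B : Type*} [CStarAlgebra B] :
    IsJacobsonSemisimple B := by
  refine eq_bot_iff.2 fun x hx => ?_
  have h1 := spectrum_subset_of_mem_ringJacobson (Ideal.mul_mem_left _ (star x) hx)
  have h2 : spectralRadius ℂ (star x * x) = 0 := by
    refine le_antisymm (iSup₂_le fun c hc => ?_) zero_le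
    simp [Set.mem_singleton_iff.1 (h1 hc)]
  rw [(IsSelfAdjoint.star_mul_self x).spectralRadius_eq_nnnorm] at h2
  simpa using h2

theorem IsCStarAlgebra.isJacobsonSemisimple {B : Type*} [NormedRing B] [NormedAlgebra ℂ B]
    [CompleteSpace B] (hB : IsCStarAlgebra B) : IsJacobsonSemisimple B := by
  obtain ⟨_, _, _⟩ := hB
  let : CStarAlgebra B := {}
  exact CStarAlgebra.isJacobsonSemisimple

theorem mainTheorem12 {A B : Type*}
    [NormedRing A] [NormedAlgebra ℂ A] [CompleteSpace A]
    [NormedRing B] [NormedAlgebra ℂ B] [CompleteSpace B]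
    (n : ℕ) (hn : 1 ≤ n) (φ : A →ₗ[ℂ] B)
    (hunital : φ 1 = 1) (hφ : IsMixedJordanHom n φ) :
    (IsJacobsonSemisimple B → (∀ x y : B, x * y = y * x) → Continuous φ) ∧
    (IsJacobsonSemisimple B → Function.Surjective φ → Continuous φ) ∧
    (IsCStarAlgebra B → Function.Surjective φ → Continuous φ) := by
  let ψ : A →ₐ[ℂ] B := AlgHom.ofLinearMap φ hunital (hφ.map_mul hn hunital)
  refine ⟨fun hB hcomm => ?_, fun hB hsurj => ψ.continuous_of_surjective hB hsurj,
    fun hB hsurj => ψ.continuous_of_surjective hB.isJacobsonSemisimple hsurj⟩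
  let : NormedCommRing B := { ‹NormedRing B› with mul_comm := hcomm }
  exact AlgHom.continuous_of_commutative hB ψ
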